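/- Let $D \ge 0$, $M\ge 2$, $N\ge 1$ be integers, let $C_1, C_3, C_4, d_{\min}$ be real constants, and let $\rho:\mathbb R\to[0,\infty)$ be $L_\rho$-Lipschitz. Let $\mathcal X\subseteq\{x\in\mathbb R^D : \|x\|_2\le C_1\}$ be the input space and let $\mathcal Q$ be a probability distribution on pairs $(x,y)$ with $x\in\mathcal X$ and $y\in\{-1,1\}$ almost surely. Let $\mathcal F$ be the class of two-layer networks $$f(x)=\sum_{m=1}^M v_m\phi_m(x),\qquad \phi_m(x)=\rho(w_m^{T}x),$$ with $w_1,\dots,w_M\in\mathbb R^D$, $\|w_m\|_2\le C_3$ for every $m$, $v\in\mathbb R^M$, $\|v\|_\infty\le C_4$, and whose features are diverse on the input space, that is $$\frac{1}{2M(M-1)}\sum_{n\ne m}\bigl(\phi_n(x)-\phi_m(x)\bigr)^2\ \ge\ d_{\min}^2\qquad\text{for every } x\in\mathcal X,$$ the sum being over ordered pairs $(n,m)$ with $n\neq m$ in $\{1,\dots,M\}$. With the hinge loss $l(f(x),y)=\max(0,\,1-y f(x))$, let $$L(f)=\mathbb E_{(x,y)\sim\mathcal Q}\bigl[l(f(x),y)\bigr],\qquad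 \hat L(f)=\frac1N\sum_{i=1}^N l(f(x_i),y_i)$$ be the expected risk and the empirical risk on an i.i.d. sample $(x_1,y_1),\dots,(x_N,y_N)$ from $\mathcal Q$. Let $f^*\in\mathcal F$ be a minimizer of $L$ over $\mathcal F$, and let $0<\delta<1$. Then with probability at least $1-\delta$ over the sample, every minimizer $\hat f\in\mathcal F$ of $\hat L$ over $\mathcal F$ satisfies $$L(\hat f)-L(f^*)\ \le\ \frac{A}{\sqrt N}+\bigl(1+\sqrt{\mathcal J}\bigr)\sqrt{\frac{2\log(2/\delta)}{N}},$$ where $C_5=L_\rho C_1C_3+\rho(0)$, $\ A=4\bigl(2L_\rho C_1C_3C_4+C_4|\rho(0)|\bigr)M$ and $\ \mathcal J=C_4^2\bigl(MC_5^2+M(M-1)(C_5^2-d_{\min}^2)\bigr)$. -/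

import Mathlib

namespace DiverseNet

noncomputable section

/-- The hidden features `φ_m(x) = ρ(w_mᵀ x)` of a two-layer network. -/
def feature {D M : ℕ} (ρ : ℝ → ℝ) (W : Fin M → EuclideanSpace ℝ (Fin D))
    (x : EuclideanSpace ℝ (Fin D)) (m : Fin M) : ℝ :=
  ρ (inner ℝ (W m) x)

/-- The network function `f(x) = ∑ m, v_m φ_m(x)`. -/
def network {D M : ℕ} (ρ : ℝ → ℝ) (W : Fin M → EuclideanSpace ℝ (Fin D))
    (v : Fin M → ℝ) (x : EuclideanSpace ℝ (Fin D)) : ℝ :=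
  ∑ m, v m * feature ρ W x m

/-- The feature diversity at the input `x`:
`1 / (2 M (M - 1)) * ∑_{n ≠ m} (φ_n(x) - φ_m(x))²`, the sum being over ordered pairs. -/
def diversity {D M : ℕ} (ρ : ℝ → ℝ) (W : Fin M → EuclideanSpace ℝ (Fin D))
    (x : EuclideanSpace ℝ (Fin D)) : ℝ :=
  1 / (2 * (M : ℝ) * ((M : ℝ) - 1)) *
    ∑ n : Fin M, ∑ m : Fin M with n ≠ m, (feature ρ W x n - feature ρ W x m) ^ 2

/-- The class of two-layer networks with `M` hidden units, `‖w_m‖₂ ≤ C₃`, `‖v‖_∞ ≤ C₄`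
(the norm of `Fin M → ℝ` is the sup norm) and feature diversity at least `dmin²` at every
input of the input space `X`. -/
def hypothesisClass {D : ℕ} (M : ℕ) (ρ : ℝ → ℝ) (X : Set (EuclideanSpace ℝ (Fin D)))
    (C₃ C₄ dmin : ℝ) : Set (EuclideanSpace ℝ (Fin D) → ℝ) :=
  {f | ∃ (W : Fin M → EuclideanSpace ℝ (Fin D)) (v : Fin M → ℝ),
    (∀ m, ‖W m‖ ≤ C₃) ∧ ‖v‖ ≤ C₄ ∧ (∀ x ∈ X, dmin ^ 2 ≤ diversity ρ W x) ∧
    f = network ρ W v}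

/-- The hinge loss `l(f(x), y) = max (0, 1 - y f(x))`. -/
def hingeLoss (t y : ℝ) : ℝ := max 0 (1 - y * t)

/-- The expected risk `L(f)` under the data distribution `Q`. -/
def expectedRisk {D : ℕ} (Q : MeasureTheory.Measure (EuclideanSpace ℝ (Fin D) × ℝ))
    (f : EuclideanSpace ℝ (Fin D) → ℝ) : ℝ :=
  ∫ z, hingeLoss (f z.1) z.2 ∂Q

/-- The empirical risk of `f` on the sample `S`. -/
def empiricalRisk {D N : ℕ} (S : Fin N → EuclideanSpace ℝ (Fin D) × ℝ)
    (f : EuclideanSpace ℝ (Fin D) → ℝ) : ℝ :=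
  1 / (N : ℝ) * ∑ i, hingeLoss (f (S i).1) (S i).2

/-- `f` is a minimizer of the functional `R` over the class `F`. -/
def IsRiskMinimizer {D : ℕ} (R : (EuclideanSpace ℝ (Fin D) → ℝ) → ℝ)
    (F : Set (EuclideanSpace ℝ (Fin D) → ℝ)) (f : EuclideanSpace ℝ (Fin D) → ℝ) : Prop :=
  f ∈ F ∧ IsMinOn R F f

/-- `C₅ = L_ρ C₁ C₃ + ρ(0)`. -/
def constC₅ (ρ : ℝ → ℝ) (Lρ C₁ C₃ : ℝ) : ℝ := Lρ * C₁ * C₃ + ρ 0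

/-- `J = C₄² (M C₅² + M (M - 1) (C₅² - dmin²))`. -/
def constJ (M : ℕ) (ρ : ℝ → ℝ) (Lρ C₁ C₃ C₄ dmin : ℝ) : ℝ :=
  C₄ ^ 2 * ((M : ℝ) * constC₅ ρ Lρ C₁ C₃ ^ 2
    + (M : ℝ) * ((M : ℝ) - 1) * (constC₅ ρ Lρ C₁ C₃ ^ 2 - dmin ^ 2))

/-- `A = 4 (2 L_ρ C₁ C₃ C₄ + C₄ |ρ(0)|) M`. -/
def constA (M : ℕ) (ρ : ℝ → ℝ) (Lρ C₁ C₃ C₄ : ℝ) : ℝ :=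
  4 * (2 * Lρ * (C₁ * C₃ * C₄) + C₄ * |ρ 0|) * (M : ℝ)

end

end DiverseNet

/-! The excess risk of an empirical minimizer is controlled by a one-sided empirical process: since
`fHat` has no larger empirical risk than `fStar`, `L(fHat) - L(fStar)` is at most the supremum over
the class of (true excess risk) minus (empirical excess risk), both taken relative to `fStar`.
Keeping the fixed comparator inside the process makes one tail bound enough.

The mean of the supremum is bounded by symmetrization (`integral_sup'_le_rademacher`),
Ledoux–Talagrand contraction through the hinge loss and through `ρ`, and an `L²` estimate of
Rademacher sums of vectors. Its fluctuation is bounded by McDiarmid's inequality, since each loss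
lies in `[0, 1 + √J]`.

Diversity enters only in that range (`abs_network_le`): `(∑ φ_m)² = M ∑ φ_m² - M(M-1) · diversity`,
so diverse features have a smaller sum.

Suprema are taken over finite families, then over a countable one by monotone limits, then over the
whole class by density of a sequence of parameters and continuity of the risks. -/

namespace DiverseNet

/-! ### Rademacher averages: contraction and linear classes -/

/-- The Rademacher sign `±1` encoded by a Boolean. -/
def boolSign (b : Bool) : ℝ := if b then 1 else -1

@[simp] theorem boolSign_true : boolSign true = 1 := rfl

@[simp] theorem boolSign_false : boolSign false = -1 := rfl

theorem sum_bool_cons {n : ℕ} (f : (Fin (n + 1) → Bool) → ℝ) :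
    ∑ σ, f σ = ∑ σ : Fin n → Bool, (f (Fin.cons true σ) + f (Fin.cons false σ)) := by
  rw [← (Fin.consEquiv (fun _ : Fin (n + 1) => Bool)).sum_comp, Fintype.sum_prod_type,
    Fintype.sum_bool, Finset.sum_add_distrib]
  rfl

/-- With maximizers `θ`, `θ'` of the two left suprema, `p θ - p θ' ≤ |q θ - q θ'|`. The sign of `q θ
- q θ'` decides which of `θ`, `θ'` to test in which right supremum. -/
theorem sup'_add_sup'_contraction {ι : Type*} {F : Finset ι} (hF : F.Nonempty) (a p q : ι → ℝ)
    (h : ∀ θ θ', |p θ - p θ'| ≤ |q θ - q θ'|) :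
    F.sup' hF (fun θ => a θ + p θ) + F.sup' hF (fun θ => a θ - p θ) ≤
      F.sup' hF (fun θ => a θ + q θ) + F.sup' hF (fun θ => a θ - q θ) := by
  obtain ⟨θ, hθ, e⟩ := Finset.exists_mem_eq_sup' hF (fun θ => a θ + p θ)
  obtain ⟨θ', hθ', e'⟩ := Finset.exists_mem_eq_sup' hF (fun θ => a θ - p θ)
  rw [e, e']
  have h1 := Finset.le_sup' (fun θ => a θ + q θ) hθ
  have h2 := Finset.le_sup' (fun θ => a θ - q θ) hθ
  have h3 := Finset.le_sup' (fun θ => a θ + q θ) hθ'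
  have h4 := Finset.le_sup' (fun θ => a θ - q θ) hθ'
  have h5 := (le_abs_self _).trans (h θ θ')
  rcases abs_cases (q θ - q θ') with ⟨h6, _⟩ | ⟨h6, _⟩ <;> linarith

/-- The Ledoux–Talagrand contraction principle for finite index sets. -/
theorem sum_sup'_contraction {ι : Type*} {F : Finset ι} (hF : F.Nonempty) {n : ℕ}
    (p q : Fin n → ι → ℝ) (h : ∀ i θ θ', |p i θ - p i θ'| ≤ |q i θ - q i θ'|) (a : ι → ℝ) :
    ∑ σ : Fin n → Bool, F.sup' hF (fun θ => a θ + ∑ i, boolSign (σ i) * p i θ) ≤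
      ∑ σ : Fin n → Bool, F.sup' hF (fun θ => a θ + ∑ i, boolSign (σ i) * q i θ) := by
  induction n generalizing a with
  | zero => simp
  | succ n ih =>
    have key := fun b => ih (fun i => p i.succ) (fun i => q i.succ) (fun i => h i.succ) b
    rw [sum_bool_cons, sum_bool_cons]
    simp only [Fin.sum_univ_succ, Fin.cons_zero, Fin.cons_succ, boolSign_true, boolSign_false,
      one_mul, neg_mul]
    -- The first coordinate is absorbed into the offset with either sign; the two-point inequality
    -- then replaces `p 0` by `q 0` for each remaining sign vector.
    have k1 := key fun θ => a θ + p 0 θ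
    have k2 := key fun θ => a θ + -p 0 θ
    simp only [add_assoc] at k1 k2
    rw [Finset.sum_add_distrib]
    refine (add_le_add k1 k2).trans ?_
    rw [← Finset.sum_add_distrib]
    refine Finset.sum_le_sum fun σ _ => ?_
    have := sup'_add_sup'_contraction hF
      (fun θ => a θ + ∑ i : Fin n, boolSign (σ i) * q i.succ θ) (p 0) (q 0) (h 0)
    refine (le_of_eq ?_).trans (this.trans (le_of_eq ?_)) <;> congr 1 <;> congr 1 <;> funext θ <;>
      ring

/-- Cross terms cancel between opposite signs: one parallelogram law per coordinate, with `a`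
carrying the induction. -/
theorem sum_norm_sq_rademacher {E : Type*} [NormedAddCommGroup E] [InnerProductSpace ℝ E] {n : ℕ}
    (x : Fin n → E) (a : E) :
    ∑ σ : Fin n → Bool, ‖a + ∑ i, boolSign (σ i) • x i‖ ^ 2 =
      2 ^ n * (‖a‖ ^ 2 + ∑ i, ‖x i‖ ^ 2) := by
  induction n generalizing a with
  | zero => simp
  | succ n ih =>
    rw [sum_bool_cons, Finset.sum_add_distrib]
    simp only [Fin.sum_univ_succ, Fin.cons_zero, Fin.cons_succ, boolSign_true, boolSign_false,
      one_smul, neg_smul, ← add_assoc]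
    rw [ih, ih]
    have := parallelogram_law_with_norm ℝ a (x 0)
    rw [← sub_eq_add_neg, pow_succ]
    linear_combination (2 : ℝ) ^ n * this

/-- Cauchy–Schwarz over the `2 ^ n` sign vectors reduces this to the second moment. -/
theorem sum_norm_rademacher_le {E : Type*} [NormedAddCommGroup E] [InnerProductSpace ℝ E] {n : ℕ}
    (x : Fin n → E) {C : ℝ} (hC : 0 ≤ C) (hx : ∀ i, ‖x i‖ ≤ C) :
    ∑ σ : Fin n → Bool, ‖∑ i, boolSign (σ i) • x i‖ ≤ 2 ^ n * (C * √n) := by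
  have h1 := sum_norm_sq_rademacher x 0
  simp only [zero_add, norm_zero, ne_eq, OfNat.ofNat_ne_zero, not_false_eq_true, zero_pow] at h1
  have h2 := sq_sum_le_card_mul_sum_sq (s := (Finset.univ : Finset (Fin n → Bool)))
    (f := fun σ => ‖∑ i, boolSign (σ i) • x i‖)
  rw [h1] at h2
  have h3 : ∑ i, ‖x i‖ ^ 2 ≤ n * C ^ 2 := by
    calc ∑ i, ‖x i‖ ^ 2 ≤ ∑ _i : Fin n, C ^ 2 :=
          Finset.sum_le_sum fun i _ => by gcongr; exact hx i
      _ = n * C ^ 2 := by simp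
  have h4 : ((Finset.univ : Finset (Fin n → Bool)).card : ℝ) = 2 ^ n := by simp
  rw [h4] at h2
  refine abs_le_of_sq_le_sq' ?_ (by positivity) |>.2
  refine h2.trans ?_
  have : (2 ^ n * (C * √n)) ^ 2 = 2 ^ n * (2 ^ n * (n * C ^ 2)) := by
    rw [mul_pow, mul_pow, Real.sq_sqrt (Nat.cast_nonneg n)]; ring
  rw [this]
  gcongr

/-- Contraction replaces `ψ` by multiplication by `K`; the supremum of the resulting linear form
over a ball is a norm. Contraction compares increments only, so `ψ 0 = 0` is not needed. -/
theorem sum_sup'_linear_le {E : Type*} [NormedAddCommGroup E] [InnerProductSpace ℝ E] {n : ℕ}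
    {U : Finset E} (hU : U.Nonempty) {B C : ℝ} (hB : 0 ≤ B) (hC : 0 ≤ C)
    (hUB : ∀ w ∈ U, ‖w‖ ≤ B) (x : Fin n → E) (hx : ∀ i, ‖x i‖ ≤ C) {K : NNReal} {ψ : ℝ → ℝ}
    (hψ : LipschitzWith K ψ) :
    ∑ σ : Fin n → Bool, U.sup' hU (fun w => ∑ i, boolSign (σ i) * ψ (inner ℝ w (x i))) ≤
      2 ^ n * (K * C * B * √n) := by
  have h1 := sum_sup'_contraction hU (fun i w => ψ (inner ℝ w (x i)))
    (fun i w => K * inner ℝ w (x i)) (fun i w w' => by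
      have := hψ.dist_le_mul (inner ℝ w (x i)) (inner ℝ w' (x i))
      rw [Real.dist_eq, Real.dist_eq] at this
      rwa [← mul_sub, abs_mul, NNReal.abs_eq]) (fun _ => 0)
  simp only [zero_add] at h1
  refine h1.trans ?_
  calc _ ≤ ∑ σ : Fin n → Bool, K * B * ‖∑ i, boolSign (σ i) • x i‖ := by
        refine Finset.sum_le_sum fun σ _ => Finset.sup'_le hU _ fun w hw => ?_
        have : ∑ i, boolSign (σ i) * (K * inner ℝ w (x i)) =
            K * inner ℝ w (∑ i, boolSign (σ i) • x i) := by
          simp only [inner_sum, inner_smul_right, Finset.mul_sum]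
          exact Finset.sum_congr rfl fun i _ => by ring
        rw [this, mul_assoc]
        gcongr
        exact (real_inner_le_norm _ _).trans (by gcongr; exact hUB w hw)
    _ ≤ K * B * (2 ^ n * (C * √n)) := by
        rw [← Finset.mul_sum]
        gcongr
        exact sum_norm_rademacher_le x hC hx
    _ = _ := by ring

end DiverseNet

/-! ### McDiarmid's inequality on a product space -/

namespace DiverseNet
open MeasureTheory ProbabilityTheory

variable {Z : Type*} [MeasurableSpace Z]

theorem measurable_finCons (n : ℕ) :
    Measurable fun p : Z × (Fin n → Z) => (Fin.cons p.1 p.2 : Fin (n + 1) → Z) := by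
  refine measurable_pi_lambda _ fun i => ?_
  refine Fin.cases ?_ (fun j => ?_) i
  · simpa using measurable_fst
  · simpa [Function.comp_def] using (measurable_pi_apply j).comp measurable_snd

theorem integrable_of_abs_le {Ω : Type*} [MeasurableSpace Ω] {μ : Measure Ω} [IsFiniteMeasure μ]
    {f : Ω → ℝ} (hf : Measurable f) {K : ℝ} (hK : ∀ ω, |f ω| ≤ K) : Integrable f μ :=
  Integrable.of_bound hf.aestronglyMeasurable K (.of_forall hK)

theorem integral_pi_succ (Q : Measure Z) [IsProbabilityMeasure Q] {n : ℕ}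
    {f : (Fin (n + 1) → Z) → ℝ} (hf : Measurable f) {K : ℝ} (hK : ∀ S, |f S| ≤ K) :
    ∫ S, f S ∂Measure.pi (fun _ => Q) =
      ∫ z, ∫ S, f (Fin.cons z S) ∂Measure.pi (fun _ : Fin n => Q) ∂Q := by
  rw [← ((measurePreserving_piFinSuccAbove (fun _ : Fin (n + 1) => Q) 0).symm).integral_comp']
  simp_rw [MeasurableEquiv.piFinSuccAbove_symm_apply, Fin.insertNthEquiv, Fin.insertNth_zero]
  exact integral_prod _ (integrable_of_abs_le (hf.comp (measurable_finCons n)) fun p => hK _)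

theorem integral_pi_succ' (Q : Measure Z) [IsProbabilityMeasure Q] {n : ℕ}
    {f : (Fin (n + 1) → Z) → ℝ} (hf : Measurable f) {K : ℝ} (hK : ∀ S, |f S| ≤ K) :
    ∫ S, f S ∂Measure.pi (fun _ => Q) =
      ∫ S, ∫ z, f (Fin.cons z S) ∂Q ∂Measure.pi (fun _ : Fin n => Q) := by
  rw [integral_pi_succ Q hf hK]
  exact integral_integral_swap
    (integrable_of_abs_le (hf.comp (measurable_finCons n)) fun p => hK _)

/-- McDiarmid's bound on the moment generating function under bounded differences. -/
theorem integral_exp_le_of_boundedDifferences (Q : Measure Z) [IsProbabilityMeasure Q] {n : ℕ}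
    {g : (Fin n → Z) → ℝ} (hg : Measurable g) {K : ℝ} (hK : ∀ S, |g S| ≤ K) {c : ℝ}
    (hc : ∀ i S S', (∀ j, j ≠ i → S j = S' j) → |g S - g S'| ≤ c) (t : ℝ) :
    ∫ S, Real.exp (t * (g S - ∫ S', g S' ∂Measure.pi (fun _ => Q))) ∂Measure.pi (fun _ => Q) ≤
      Real.exp (n * (c ^ 2 * t ^ 2 / 8)) := by
  induction n with
  | zero =>
    have (S : Fin 0 → Z) : g S = g isEmptyElim := congrArg g (Subsingleton.elim _ _)
    simp [this]
  | succ n ih =>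
    set m := ∫ S', g S' ∂Measure.pi (fun _ => Q) with hm
    -- `h` is the conditional mean of `g` given the first coordinate. In `g - m = (g - h) + (h - m)`
    -- the first term falls to the induction hypothesis with `z` frozen, the second to Hoeffding's
    -- lemma.
    set h : Z → ℝ := fun z => ∫ S, g (Fin.cons z S) ∂Measure.pi (fun _ : Fin n => Q) with hh
    have hgc (z : Z) : Measurable fun S : Fin n → Z => g (Fin.cons z S) :=
      (hg.comp (measurable_finCons n)).comp measurable_prodMk_left
    have hgi (z : Z) : Integrable (fun S : Fin n → Z => g (Fin.cons z S))
        (Measure.pi (fun _ : Fin n => Q)) := integrable_of_abs_le (hgc z) fun _ => hK _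
    have hhm : Measurable h :=
      ((hg.comp (measurable_finCons n)).stronglyMeasurable.integral_prod_right').measurable
    have hmh : m = ∫ z, h z ∂Q := integral_pi_succ Q hg hK
    have hdiff (z z' : Z) : |h z - h z'| ≤ c := by
      rw [hh]
      simp only
      rw [← integral_sub (hgi z) (hgi z')]
      have := norm_integral_le_of_norm_le_const (μ := Measure.pi (fun _ : Fin n => Q))
        (f := fun S => g (Fin.cons z S) - g (Fin.cons z' S)) (C := c)
        (.of_forall fun S => hc 0 _ _ fun j hj => by
          obtain ⟨k, rfl⟩ := Fin.exists_succ_eq.2 hj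
          simp)
      simpa using this
    obtain ⟨z₀⟩ : Nonempty Z := nonempty_of_isProbabilityMeasure Q
    have hbdd : BddBelow (Set.range h) :=
      ⟨h z₀ - c, by rintro _ ⟨z, rfl⟩; linarith [(abs_le.1 (hdiff z z₀)).1]⟩
    have hc0 : 0 ≤ c := (abs_nonneg _).trans (hdiff z₀ z₀)
    -- Hoeffding's lemma needs an interval of length `c`, not just oscillation at most `c`; it
    -- starts at the infimum of `h`.
    have hIcc (z : Z) : h z ∈ Set.Icc (⨅ z, h z) ((⨅ z, h z) + c) := by
      have : Nonempty Z := ⟨z₀⟩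
      refine ⟨ciInf_le hbdd z, ?_⟩
      have : h z - c ≤ ⨅ z, h z := le_ciInf fun z' => by linarith [(abs_le.1 (hdiff z z')).2]
      linarith
    have hoef : ∫ z, Real.exp (t * (h z - m)) ∂Q ≤ Real.exp (c ^ 2 * t ^ 2 / 8) := by
      have := (hasSubgaussianMGF_of_mem_Icc (μ := Q) hhm.aemeasurable (.of_forall hIcc)).mgf_le t
      rw [mgf, ← hmh] at this
      refine this.trans_eq (congrArg _ ?_)
      push_cast
      rw [add_sub_cancel_left, Real.norm_of_nonneg hc0]
      ring
    have hexpb (S : Fin (n + 1) → Z) :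
        |Real.exp (t * (g S - m))| ≤ Real.exp (|t| * (K + |m|)) := by
      rw [abs_of_pos (Real.exp_pos _)]
      refine Real.exp_le_exp.2 ((le_abs_self _).trans ?_)
      rw [abs_mul]
      gcongr
      exact (abs_sub _ _).trans (by gcongr; exact hK S)
    rw [integral_pi_succ Q (by fun_prop) hexpb]
    have inner (z : Z) : ∫ S, Real.exp (t * (g (Fin.cons z S) - m)) ∂Measure.pi (fun _ : Fin n => Q)
        ≤ Real.exp (n * (c ^ 2 * t ^ 2 / 8)) * Real.exp (t * (h z - m)) := by
      have e (S : Fin n → Z) : Real.exp (t * (g (Fin.cons z S) - m)) =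
          Real.exp (t * (g (Fin.cons z S) - h z)) * Real.exp (t * (h z - m)) := by
        rw [← Real.exp_add]; ring_nf
      simp_rw [e, integral_mul_const]
      gcongr
      refine ih (hgc z) (fun _ => hK _) fun i S S' hS => hc i.succ _ _ fun j hj => ?_
      induction j using Fin.cases with
      | zero => simp
      | succ k => simpa using hS k fun hk => hj (by rw [hk])
    have hexph : Integrable (fun z => Real.exp (t * (h z - m))) Q := by
      refine integrable_of_abs_le (K := Real.exp (|t| * (K + |m|))) (by fun_prop) fun z => ?_
      rw [abs_of_pos (Real.exp_pos _)]
      refine Real.exp_le_exp.2 ((le_abs_self _).trans ?_)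
      rw [abs_mul]
      gcongr
      refine (abs_sub _ _).trans (by
        gcongr
        simpa using norm_integral_le_of_norm_le_const (μ := Measure.pi (fun _ : Fin n => Q))
          (f := fun S => g (Fin.cons z S)) (C := K) (.of_forall fun S => hK _))
    have hint : Integrable (fun z => ∫ S, Real.exp (t * (g (Fin.cons z S) - m))
        ∂Measure.pi (fun _ : Fin n => Q)) Q := by
      refine (integrable_of_abs_le (μ := Q.prod (Measure.pi (fun _ : Fin n => Q)))
        (f := fun p => Real.exp (t * (g (Fin.cons p.1 p.2) - m))) ?_
        fun p => hexpb _).integral_prod_left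
      exact (((hg.comp (measurable_finCons n)).sub_const m).const_mul t).exp
    refine (integral_mono hint (hexph.const_mul _) inner).trans ?_
    rw [integral_const_mul]
    refine (mul_le_mul_of_nonneg_left hoef (Real.exp_pos _).le).trans_eq ?_
    rw [← Real.exp_add]
    push_cast
    ring_nf

/-- McDiarmid's inequality. -/
theorem measure_ge_le_of_boundedDifferences (Q : Measure Z) [IsProbabilityMeasure Q] {n : ℕ}
    {g : (Fin n → Z) → ℝ} (hg : Measurable g) {K : ℝ} (hK : ∀ S, |g S| ≤ K) {c : ℝ}
    (hc : ∀ i S S', (∀ j, j ≠ i → S j = S' j) → |g S - g S'| ≤ c) {ε : ℝ} (hε : 0 ≤ ε) :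
    (Measure.pi fun _ : Fin n => Q).real
        {S | ε ≤ g S - ∫ S', g S' ∂Measure.pi (fun _ => Q)} ≤
      Real.exp (-(2 * ε ^ 2) / (n * c ^ 2)) := by
  set m := ∫ S', g S' ∂Measure.pi (fun _ => Q) with hm
  have hsub : HasSubgaussianMGF (fun S => g S - m) (n * (‖c‖₊ / 2) ^ 2)
      (Measure.pi fun _ : Fin n => Q) := by
    refine ⟨fun t => ?_, fun t => ?_⟩
    · refine integrable_of_abs_le (K := Real.exp (|t| * (K + |m|))) (by fun_prop) fun S => ?_
      rw [abs_of_pos (Real.exp_pos _)]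
      refine Real.exp_le_exp.2 ((le_abs_self _).trans ?_)
      rw [abs_mul]
      gcongr
      exact (abs_sub _ _).trans (by gcongr; exact hK S)
    · refine (integral_exp_le_of_boundedDifferences Q hg hK hc t).trans_eq (congrArg _ ?_)
      push_cast
      rw [div_pow, Real.norm_eq_abs, sq_abs]
      ring
  refine (hsub.measure_ge_le hε).trans_eq (congrArg _ ?_)
  push_cast
  rw [div_pow, Real.norm_eq_abs, sq_abs]
  rw [show (2 * (n * (c ^ 2 / 2 ^ 2)) : ℝ) = n * c ^ 2 / 2 by ring, div_div_eq_mul_div]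
  ring

/-! ### Suprema over finite families and symmetrization -/

section FiniteSup

variable {ι : Type*} {F : Finset ι}

theorem exists_forall_abs_le (hF : F.Nonempty) (a : ι → ℝ) : ∃ K, ∀ θ ∈ F, |a θ| ≤ K :=
  ⟨F.sup' hF fun θ => |a θ|, fun _ hθ => Finset.le_sup' (fun θ => |a θ|) hθ⟩

theorem abs_sup'_sub_sup'_le (hF : F.Nonempty) {f g : ι → ℝ} {c : ℝ} (h : ∀ θ ∈ F, |f θ - g θ| ≤ c) :
    |F.sup' hF f - F.sup' hF g| ≤ c := by
  refine abs_le.2 ⟨?_, ?_⟩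
  · have : F.sup' hF g ≤ F.sup' hF f + c := Finset.sup'_le hF _ fun θ hθ => by
      linarith [(abs_le.1 (h θ hθ)).1, Finset.le_sup' f hθ]
    linarith
  · have : F.sup' hF f ≤ F.sup' hF g + c := Finset.sup'_le hF _ fun θ hθ => by
      linarith [(abs_le.1 (h θ hθ)).2, Finset.le_sup' g hθ]
    linarith

theorem abs_sup'_le (hF : F.Nonempty) {f : ι → ℝ} {c : ℝ} (h : ∀ θ ∈ F, |f θ| ≤ c) : |F.sup' hF f| ≤ c := by
  simpa [Finset.sup'_const] using
    abs_sup'_sub_sup'_le hF (f := f) (g := fun _ => 0) (by simpa using h)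

theorem measurable_sup' (hF : F.Nonempty) {Ω : Type*} [MeasurableSpace Ω] {f : ι → Ω → ℝ}
    (hf : ∀ θ, Measurable (f θ)) : Measurable fun ω => F.sup' hF fun θ => f θ ω := by
  have := Finset.measurable_sup' hF (f := f) fun θ _ => hf θ
  convert this using 1
  ext ω
  rw [Finset.sup'_apply]

/-- Symmetrization of one coordinate without a ghost sample: `2(b + Eh - h z) = (b + 2Eh) + (b - 2h
z)`, the supremum splits over the two terms, and Jensen takes the expectation out of the first. -/
theorem two_mul_integral_sup'_le (hF : F.Nonempty) (Q : Measure Z) [IsProbabilityMeasure Q] {h : ι → Z → ℝ}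
    (hm : ∀ θ, Measurable (h θ)) {B : ℝ} (hB : ∀ θ z, |h θ z| ≤ B) (b : ι → ℝ) :
    2 * ∫ z, F.sup' hF (fun θ => b θ + (∫ z', h θ z' ∂Q - h θ z)) ∂Q ≤
      ∫ z, (F.sup' hF (fun θ => b θ + 2 * h θ z) + F.sup' hF (fun θ => b θ - 2 * h θ z)) ∂Q := by
  obtain ⟨K, hK⟩ := exists_forall_abs_le hF b
  have hint (s : ℝ) (e : ι → ℝ) : Integrable (fun z => F.sup' hF fun θ => e θ + s * h θ z) Q := by
    obtain ⟨K, hK⟩ := exists_forall_abs_le hF e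
    refine integrable_of_abs_le (K := K + |s| * B) (measurable_sup' hF fun θ => by fun_prop)
      fun z => abs_sup'_le hF fun θ hθ => (abs_add_le _ _).trans ?_
    rw [abs_mul]
    gcongr
    exacts [hK θ hθ, hB θ z]
  have i1 := hint 2 b
  have i2 : Integrable (fun z => F.sup' hF fun θ => b θ - 2 * h θ z) Q := by
    simpa [sub_eq_add_neg] using hint (-2) b
  have i3 : Integrable (fun z => F.sup' hF fun θ => b θ + (∫ z', h θ z' ∂Q - h θ z)) Q := by
    simpa [sub_eq_add_neg, add_assoc] using hint (-1) fun θ => b θ + ∫ z', h θ z' ∂Q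
  have jensen : F.sup' hF (fun θ => b θ + 2 * ∫ z, h θ z ∂Q) ≤
      ∫ z, F.sup' hF (fun θ => b θ + 2 * h θ z) ∂Q := by
    refine Finset.sup'_le hF _ fun θ hθ => ?_
    have hi : Integrable (h θ) Q := integrable_of_abs_le (hm θ) (hB θ)
    have e : b θ + 2 * ∫ z, h θ z ∂Q = ∫ z, (b θ + 2 * h θ z) ∂Q := by
      rw [integral_add (integrable_const _) (hi.const_mul _), integral_const_mul]
      simp
    rw [e]
    exact integral_mono ((integrable_const _).add (hi.const_mul _)) i1
      fun z => Finset.le_sup' (fun θ => b θ + 2 * h θ z) hθ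
  rw [integral_add i1 i2, ← integral_const_mul]
  calc _ ≤ ∫ z, (F.sup' hF (fun θ => b θ + 2 * ∫ z, h θ z ∂Q) +
          F.sup' hF (fun θ => b θ - 2 * h θ z)) ∂Q := by
        refine integral_mono (i3.const_mul _) ((integrable_const _).add i2) fun z => ?_
        obtain ⟨θ, hθ, e⟩ :=
          Finset.exists_mem_eq_sup' hF fun θ => b θ + (∫ z', h θ z' ∂Q - h θ z)
        simp only [e]
        linarith [Finset.le_sup' (fun θ => b θ + 2 * ∫ z, h θ z ∂Q) hθ,
          Finset.le_sup' (fun θ => b θ - 2 * h θ z) hθ]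
    _ ≤ _ := by
        rw [integral_add (integrable_const _) i2]
        simpa using jensen

/-- Symmetrization: the expected supremum of the centred empirical process is controlled by its
Rademacher average. -/
theorem integral_sup'_le_rademacher (hF : F.Nonempty) (Q : Measure Z)
    [IsProbabilityMeasure Q] {h : ι → Z → ℝ}
    (hm : ∀ θ, Measurable (h θ)) {B : ℝ} (hB : ∀ θ z, |h θ z| ≤ B) (n : ℕ) (a : ι → ℝ) :
    2 ^ n * ∫ S, F.sup' hF (fun θ => a θ + ∑ i, (∫ z, h θ z ∂Q - h θ (S i)))
        ∂Measure.pi (fun _ : Fin n => Q) ≤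
      ∫ S, ∑ σ : Fin n → Bool, F.sup' hF (fun θ => a θ + ∑ i, boolSign (σ i) * (2 * h θ (S i)))
        ∂Measure.pi (fun _ : Fin n => Q) := by
  have habs (θ : ι) : |∫ z, h θ z ∂Q| ≤ B := by
    simpa using norm_integral_le_of_norm_le_const (μ := Q) (f := h θ) (.of_forall (hB θ))
  have hsign (b : Bool) : |boolSign b| = 1 := by cases b <;> simp
  have hmL (m : ℕ) (a : ι → ℝ) : Measurable fun S : Fin m → Z =>
      F.sup' hF fun θ => a θ + ∑ i, (∫ z, h θ z ∂Q - h θ (S i)) :=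
    measurable_sup' hF fun θ => by fun_prop
  have hbL (m : ℕ) (a : ι → ℝ) : ∃ K, ∀ S : Fin m → Z,
      |F.sup' hF fun θ => a θ + ∑ i, (∫ z, h θ z ∂Q - h θ (S i))| ≤ K := by
    obtain ⟨K, hK⟩ := exists_forall_abs_le hF a
    refine ⟨K + ∑ _i : Fin m, (B + B), fun S => abs_sup'_le hF fun θ hθ => ?_⟩
    refine (abs_add_le _ _).trans (add_le_add (hK θ hθ) ((Finset.abs_sum_le_sum_abs _ _).trans ?_))
    exact Finset.sum_le_sum fun i _ => (abs_sub _ _).trans (add_le_add (habs θ) (hB _ _))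
  have hmR (m : ℕ) (a : ι → ℝ) : Measurable fun S : Fin m → Z => ∑ σ : Fin m → Bool,
      F.sup' hF fun θ => a θ + ∑ i, boolSign (σ i) * (2 * h θ (S i)) :=
    Finset.measurable_sum _ fun σ _ => measurable_sup' hF fun θ => by fun_prop
  have hbR (m : ℕ) (a : ι → ℝ) {K : ℝ} (hK : ∀ θ ∈ F, |a θ| ≤ K) (σ : Fin m → Bool)
      (S : Fin m → Z) : |F.sup' hF fun θ => a θ + ∑ i, boolSign (σ i) * (2 * h θ (S i))| ≤
        K + m * (2 * B) := by
    refine abs_sup'_le hF fun θ hθ => (abs_add_le _ _).trans (add_le_add (hK θ hθ) ?_)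
    calc _ ≤ ∑ _i : Fin m, 2 * B := (Finset.abs_sum_le_sum_abs _ _).trans
            (Finset.sum_le_sum fun i _ => by
              rw [abs_mul, hsign, one_mul, abs_mul, abs_two]
              gcongr
              exact hB _ _)
      _ = m * (2 * B) := by simp
  have hbR' (m : ℕ) (a : ι → ℝ) {K : ℝ} (hK : ∀ θ ∈ F, |a θ| ≤ K) (S : Fin m → Z) :
      |∑ σ : Fin m → Bool, F.sup' hF fun θ => a θ + ∑ i, boolSign (σ i) * (2 * h θ (S i))| ≤
        ∑ _σ : Fin m → Bool, (K + m * (2 * B)) :=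
    (Finset.abs_sum_le_sum_abs _ _).trans (Finset.sum_le_sum fun σ _ => hbR m a hK σ S)
  induction n generalizing a with
  | zero => simp
  | succ n ih =>
    obtain ⟨K, hK⟩ := exists_forall_abs_le hF a
    obtain ⟨K', hK'⟩ := hbL (n + 1) a
    have hKz (z : Z) (θ) (hθ : θ ∈ F) : |a θ + (∫ z, h θ z ∂Q - h θ z)| ≤ K + (B + B) :=
      (abs_add_le _ _).trans
        (add_le_add (hK θ hθ) ((abs_sub _ _).trans (add_le_add (habs θ) (hB _ _))))
    -- The new coordinate is integrated last on the left, so that the induction hypothesis applies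
    -- with `z` frozen, and first on the right, so that the one-coordinate inequality applies with
    -- `S` and `σ` frozen. Fubini joins the two.
    rw [integral_pi_succ Q (hmL _ a) hK', integral_pi_succ' Q (hmR _ a) (hbR' _ a hK)]
    have hjoint : Measurable fun p : Z × (Fin n → Z) => ∑ σ : Fin n → Bool, F.sup' hF fun θ =>
        a θ + (∫ z, h θ z ∂Q - h θ p.1) + ∑ i, boolSign (σ i) * (2 * h θ (p.2 i)) :=
      Finset.measurable_sum _ fun σ _ => measurable_sup' hF fun θ => by fun_prop
    have hjointi : Integrable (fun p : Z × (Fin n → Z) => ∑ σ : Fin n → Bool, F.sup' hF fun θ =>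
        a θ + (∫ z, h θ z ∂Q - h θ p.1) + ∑ i, boolSign (σ i) * (2 * h θ (p.2 i)))
        (Q.prod (Measure.pi fun _ : Fin n => Q)) :=
      integrable_of_abs_le hjoint fun p => hbR' n _ (hKz p.1) p.2
    have step1 (z : Z) : 2 ^ n * ∫ S, F.sup' hF (fun θ => a θ + ∑ i : Fin (n + 1),
          (∫ z, h θ z ∂Q - h θ ((Fin.cons z S : Fin (n + 1) → Z) i)))
          ∂Measure.pi (fun _ : Fin n => Q) ≤
        ∫ S, ∑ σ : Fin n → Bool, F.sup' hF (fun θ => a θ + (∫ z, h θ z ∂Q - h θ z) +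
          ∑ i, boolSign (σ i) * (2 * h θ (S i))) ∂Measure.pi (fun _ : Fin n => Q) := by
      simpa only [Fin.sum_univ_succ, Fin.cons_zero, Fin.cons_succ, ← add_assoc] using
        ih fun θ => a θ + (∫ z, h θ z ∂Q - h θ z)
    have hcL : Measurable fun p : Z × (Fin n → Z) => F.sup' hF (fun θ => a θ + ∑ i : Fin (n + 1),
          (∫ z, h θ z ∂Q - h θ ((Fin.cons p.1 p.2 : Fin (n + 1) → Z) i))) :=
      (hmL (n + 1) a).comp (measurable_finCons n)
    have hcLi : Integrable (fun p : Z × (Fin n → Z) => F.sup' hF (fun θ => a θ +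
        ∑ i : Fin (n + 1), (∫ z, h θ z ∂Q - h θ ((Fin.cons p.1 p.2 : Fin (n + 1) → Z) i))))
        (Q.prod (Measure.pi fun _ : Fin n => Q)) :=
      integrable_of_abs_le hcL fun p => hK' _
    have hcR : Integrable (fun p : Z × (Fin n → Z) => ∑ σ : Fin (n + 1) → Bool, F.sup' hF
        (fun θ => a θ + ∑ i, boolSign (σ i) *
          (2 * h θ ((Fin.cons p.1 p.2 : Fin (n + 1) → Z) i))))
        (Q.prod (Measure.pi fun _ : Fin n => Q)) :=
      integrable_of_abs_le ((hmR (n + 1) a).comp (measurable_finCons n))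
        fun p => hbR' _ a hK _
    calc _ = 2 * ∫ z, 2 ^ n * ∫ S, F.sup' hF (fun θ => a θ + ∑ i : Fin (n + 1),
          (∫ z, h θ z ∂Q - h θ ((Fin.cons z S : Fin (n + 1) → Z) i)))
          ∂Measure.pi (fun _ : Fin n => Q) ∂Q := by
          rw [integral_const_mul, pow_succ]; ring
      _ ≤ 2 * ∫ z, ∫ S, ∑ σ : Fin n → Bool, F.sup' hF (fun θ => a θ +
          (∫ z, h θ z ∂Q - h θ z) + ∑ i, boolSign (σ i) * (2 * h θ (S i)))
          ∂Measure.pi (fun _ : Fin n => Q) ∂Q := by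
          exact mul_le_mul_of_nonneg_left (integral_mono
            (hcLi.integral_prod_left.const_mul _) hjointi.integral_prod_left step1) zero_le_two
      _ = ∫ S, 2 * ∫ z, ∑ σ : Fin n → Bool, F.sup' hF (fun θ => a θ +
          (∫ z, h θ z ∂Q - h θ z) + ∑ i, boolSign (σ i) * (2 * h θ (S i)))
          ∂Q ∂Measure.pi (fun _ : Fin n => Q) := by
          rw [integral_const_mul, integral_integral_swap hjointi]
      _ ≤ _ := by
          refine integral_mono (hjointi.integral_prod_right.const_mul _)
            hcR.integral_prod_right fun S => ?_
          simp only [sum_bool_cons, Fin.sum_univ_succ, Fin.cons_zero, Fin.cons_succ,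
            boolSign_true, boolSign_false, one_mul, neg_mul]
          have hm1 (s : ℝ) (b : ι → ℝ) :
              Integrable (fun z => F.sup' hF fun θ => b θ + s * h θ z) Q := by
            obtain ⟨K, hK⟩ := exists_forall_abs_le hF b
            refine integrable_of_abs_le (K := K + |s| * B)
              (measurable_sup' hF fun θ => by fun_prop)
              fun z => abs_sup'_le hF fun θ hθ => (abs_add_le _ _).trans ?_
            rw [abs_mul]
            gcongr
            exacts [hK θ hθ, hB θ z]
          have e1 (σ : Fin n → Bool) (z : Z) : (F.sup' hF fun θ => a θ +
              (∫ z, h θ z ∂Q - h θ z) + ∑ i, boolSign (σ i) * (2 * h θ (S i))) =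
              F.sup' hF fun θ => (a θ + ∑ i, boolSign (σ i) * (2 * h θ (S i)) +
                ∫ z, h θ z ∂Q) + (-1) * h θ z := by
            congr 1; funext θ; ring
          have e2 (σ : Fin n → Bool) (z : Z) : (F.sup' hF fun θ => a θ + (2 * h θ z +
              ∑ i, boolSign (σ i) * (2 * h θ (S i)))) =
              F.sup' hF fun θ => (a θ + ∑ i, boolSign (σ i) * (2 * h θ (S i))) + 2 * h θ z := by
            congr 1; funext θ; ring
          have e3 (σ : Fin n → Bool) (z : Z) : (F.sup' hF fun θ => a θ + (-(2 * h θ z) +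
              ∑ i, boolSign (σ i) * (2 * h θ (S i)))) =
              F.sup' hF fun θ => (a θ + ∑ i, boolSign (σ i) * (2 * h θ (S i))) + (-2) * h θ z := by
            congr 1; funext θ; ring
          simp only [e1, e2, e3]
          have hm2 (b : ι → ℝ) : Integrable (fun z => (F.sup' hF fun θ => b θ + 2 * h θ z) +
              F.sup' hF fun θ => b θ + (-2) * h θ z) Q := (hm1 2 b).add (hm1 (-2) b)
          rw [integral_finsetSum _ fun σ _ => hm1 _ _, integral_finsetSum _ fun σ _ => hm2 _,
            Finset.mul_sum]
          refine Finset.sum_le_sum fun σ _ => ?_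
          have := two_mul_integral_sup'_le hF Q hm hB
            fun θ => a θ + ∑ i, boolSign (σ i) * (2 * h θ (S i))
          refine (le_of_eq ?_).trans (this.trans (le_of_eq ?_))
          · congr 2; funext z; congr 1; funext θ; ring
          · congr 1; funext z; congr 2; funext θ; ring

end FiniteSup
-- Concentration of the excess process
/-- Concentration of the supremum of the empirical process of excess losses over a finite class
with bounded Rademacher averages. -/
theorem measure_sup'_excess_ge_le {ι : Type*} {F : Finset ι} (hF : F.Nonempty) (Q : Measure Z)
    [IsProbabilityMeasure Q] {n : ℕ} (hn : 1 ≤ n) {h : ι → Z → ℝ} {h₀ : Z → ℝ} {B R δ : ℝ}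
    (hm : ∀ θ, Measurable (h θ)) (hB : ∀ θ z, h θ z ∈ Set.Icc 0 B)
    (hm₀ : Measurable h₀) (hB₀ : ∀ z, h₀ z ∈ Set.Icc 0 B) (hB_pos : 0 < B)
    (hR : ∀ S : Fin n → Z, ∑ σ : Fin n → Bool,
      F.sup' hF (fun θ => ∑ i, boolSign (σ i) * h θ (S i)) ≤ 2 ^ n * R)
    (hδ_pos : 0 < δ) (hδ_lt : δ < 1) :
    (Measure.pi fun _ : Fin n => Q) {S | 2 * R + B * √(2 * n * Real.log (1 / δ)) ≤
      F.sup' hF fun θ => ∑ i, ((∫ z, h θ z ∂Q - ∫ z, h₀ z ∂Q) - (h θ (S i) - h₀ (S i)))} ≤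
      ENNReal.ofReal δ := by
  have habs (θ : ι) (z : Z) : |h θ z| ≤ B := by
    rw [abs_of_nonneg (hB θ z).1]; exact (hB θ z).2
  have habs₀ (z : Z) : |h₀ z| ≤ B := by
    rw [abs_of_nonneg (hB₀ z).1]; exact (hB₀ z).2
  set P := Measure.pi fun _ : Fin n => Q with hP
  set g : (Fin n → Z) → ℝ := fun S =>
    F.sup' hF fun θ => ∑ i, ((∫ z, h θ z ∂Q - ∫ z, h₀ z ∂Q) - (h θ (S i) - h₀ (S i))) with hg
  have hgm : Measurable g := measurable_sup' hF fun θ => by fun_prop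
  obtain ⟨K, hK⟩ := exists_forall_abs_le hF fun θ => ∫ z, h θ z ∂Q - ∫ z, h₀ z ∂Q
  have hgb (S : Fin n → Z) : |g S| ≤ ∑ _i : Fin n, (K + (B + B)) :=
    abs_sup'_le hF fun θ hθ => (Finset.abs_sum_le_sum_abs _ _).trans <|
      Finset.sum_le_sum fun i _ => (abs_sub _ _).trans <|
        add_le_add (hK θ hθ) ((abs_sub _ _).trans (add_le_add (habs θ _) (habs₀ _)))
  -- Each `h θ - h₀` takes values in `[-B, B]`, so changing one sample point moves the sum by at
  -- most `2 * B`.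
  have hgc (i : Fin n) (S S' : Fin n → Z) (hS : ∀ j, j ≠ i → S j = S' j) :
      |g S - g S'| ≤ 2 * B := by
    refine abs_sup'_sub_sup'_le hF fun θ _ => ?_
    rw [← Finset.sum_sub_distrib, Finset.sum_eq_single i]
    · have h1 := hB θ (S i)
      have h2 := hB θ (S' i)
      have h3 := hB₀ (S i)
      have h4 := hB₀ (S' i)
      rw [abs_le]
      constructor <;> linarith [h1.1, h1.2, h2.1, h2.2, h3.1, h3.2, h4.1, h4.2]
    · intro j _ hj
      rw [hS j hj, sub_self]
    · simp
  -- The centred comparator sum does not depend on `θ` and has mean zero, so it leaves the supremum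
  -- and only `h` is symmetrized.
  have hmean : ∫ S, g S ∂P ≤ 2 * R := by
    have hk : Measurable fun S : Fin n → Z => F.sup' hF fun θ =>
        ∑ i, (∫ z, h θ z ∂Q - h θ (S i)) := measurable_sup' hF fun θ => by fun_prop
    obtain ⟨K', hK'⟩ := exists_forall_abs_le hF fun θ => ∫ z, h θ z ∂Q
    have hki : Integrable (fun S : Fin n → Z => F.sup' hF fun θ =>
        ∑ i, (∫ z, h θ z ∂Q - h θ (S i))) P :=
      integrable_of_abs_le (K := ∑ _i : Fin n, (K' + B)) hk fun S => abs_sup'_le hF fun θ hθ =>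
        (Finset.abs_sum_le_sum_abs _ _).trans <| Finset.sum_le_sum fun i _ =>
          (abs_sub _ _).trans (add_le_add (hK' θ hθ) (habs θ _))
    have hev (i : Fin n) : ∫ S : Fin n → Z, h₀ (S i) ∂P = ∫ z, h₀ z ∂Q :=
      integral_comp_eval (μ := fun _ : Fin n => Q) (i := i) hm₀.aestronglyMeasurable
    have hevi (i : Fin n) : Integrable (fun S : Fin n → Z => ∫ z, h₀ z ∂Q - h₀ (S i)) P :=
      (integrable_const _).sub (integrable_of_abs_le (by fun_prop) fun S => habs₀ (S i))
    have hzero : ∫ S : Fin n → Z, ∑ i, (∫ z, h₀ z ∂Q - h₀ (S i)) ∂P = 0 := by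
      rw [integral_finsetSum _ fun i _ => hevi i]
      refine Finset.sum_eq_zero fun i _ => ?_
      have hi : Integrable (fun S : Fin n → Z => h₀ (S i)) P :=
        integrable_of_abs_le (by fun_prop) fun S => habs₀ (S i)
      rw [integral_sub (integrable_const _) hi, hev]
      simp
    have hle : ∫ S, g S ∂P ≤ ∫ S : Fin n → Z, ((F.sup' hF fun θ =>
        ∑ i, (∫ z, h θ z ∂Q - h θ (S i))) - ∑ i, (∫ z, h₀ z ∂Q - h₀ (S i))) ∂P := by
      refine integral_mono (integrable_of_abs_le hgm hgb)
        (hki.sub (integrable_finsetSum _ fun i _ => hevi i)) fun S => ?_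
      refine Finset.sup'_le hF _ fun θ hθ => ?_
      have := Finset.le_sup' (fun θ => ∑ i, (∫ z, h θ z ∂Q - h θ (S i))) hθ
      rw [le_sub_iff_add_le]
      refine le_trans (le_of_eq ?_) this
      rw [← Finset.sum_add_distrib]
      exact Finset.sum_congr rfl fun i _ => by ring
    rw [integral_sub hki (integrable_finsetSum _ fun i _ => hevi i), hzero, sub_zero] at hle
    have hsym := integral_sup'_le_rademacher hF Q hm habs n fun _ => 0
    simp only [zero_add] at hsym
    have hrad : ∫ S, ∑ σ : Fin n → Bool, F.sup' hF (fun θ =>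
        ∑ i, boolSign (σ i) * (2 * h θ (S i))) ∂P ≤ 2 ^ n * (2 * R) := by
      have hpt (S : Fin n → Z) : ∑ σ : Fin n → Bool, F.sup' hF (fun θ =>
          ∑ i, boolSign (σ i) * (2 * h θ (S i))) ≤ 2 ^ n * (2 * R) := by
        calc _ ≤ ∑ σ : Fin n → Bool,
              2 * F.sup' hF (fun θ => ∑ i, boolSign (σ i) * h θ (S i)) := by
              refine Finset.sum_le_sum fun σ _ => Finset.sup'_le hF _ fun θ hθ => ?_
              have := Finset.le_sup' (fun θ => ∑ i, boolSign (σ i) * h θ (S i)) hθ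
              refine le_trans (le_of_eq ?_) (mul_le_mul_of_nonneg_left this zero_le_two)
              rw [Finset.mul_sum]
              exact Finset.sum_congr rfl fun i _ => by ring
          _ ≤ _ := by rw [← Finset.mul_sum]; linarith [hR S]
      by_cases hint : Integrable (fun S : Fin n → Z => ∑ σ : Fin n → Bool, F.sup' hF (fun θ =>
          ∑ i, boolSign (σ i) * (2 * h θ (S i)))) P
      · simpa using integral_mono hint (integrable_const _) hpt
      · exfalso
        refine hint (integrable_finsetSum _ fun σ _ => ?_)
        refine integrable_of_abs_le (K := ∑ i, |boolSign (σ i)| * (2 * B))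
          (measurable_sup' hF fun θ => by fun_prop) fun S => abs_sup'_le hF fun θ _ =>
            (Finset.abs_sum_le_sum_abs _ _).trans <| Finset.sum_le_sum fun i _ => ?_
        rw [abs_mul, abs_mul, abs_two]
        gcongr
        exact habs θ _
    have h2 : (0 : ℝ) < 2 ^ n := by positivity
    exact hle.trans (le_of_mul_le_mul_left (hsym.trans hrad) h2)
  have hlog : 0 ≤ Real.log (1 / δ) := Real.log_nonneg (by rw [one_le_div hδ_pos]; exact hδ_lt.le)
  have hn' : (0 : ℝ) < n := by exact_mod_cast hn
  have hmd := measure_ge_le_of_boundedDifferences Q hgm hgb hgc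
    (ε := B * √(2 * n * Real.log (1 / δ))) (by positivity)
  have hexp : Real.exp (-(2 * (B * √(2 * n * Real.log (1 / δ))) ^ 2) / (n * (2 * B) ^ 2)) = δ := by
    rw [mul_pow, Real.sq_sqrt (by positivity)]
    have : -(2 * (B ^ 2 * (2 * n * Real.log (1 / δ)))) / (n * (2 * B) ^ 2) = Real.log δ := by
      rw [one_div, Real.log_inv]
      field_simp
    rw [this, Real.exp_log hδ_pos]
  rw [hexp] at hmd
  rw [← ENNReal.ofReal_toReal (measure_ne_top P _)]
  refine ENNReal.ofReal_le_ofReal ((measureReal_mono fun S hS => ?_).trans hmd)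
  simp only [Set.mem_ofPred_eq] at hS ⊢
  linarith

/-- Uniform high-probability bound on the excess empirical process over a countable class. -/
theorem exists_measurableSet_excess_le (Q : Measure Z) [IsProbabilityMeasure Q] {n : ℕ}
    (hn : 1 ≤ n) {h : ℕ → Z → ℝ} {h₀ : Z → ℝ} {B R δ : ℝ}
    (hm : ∀ θ, Measurable (h θ)) (hB : ∀ θ z, h θ z ∈ Set.Icc 0 B)
    (hm₀ : Measurable h₀) (hB₀ : ∀ z, h₀ z ∈ Set.Icc 0 B) (hB_pos : 0 < B)
    (hR : ∀ (F : Finset ℕ) (hF : F.Nonempty) (S : Fin n → Z), ∑ σ : Fin n → Bool,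
      F.sup' hF (fun θ => ∑ i, boolSign (σ i) * h θ (S i)) ≤ 2 ^ n * R)
    (hδ_pos : 0 < δ) (hδ_lt : δ < 1) :
    ∃ G : Set (Fin n → Z), MeasurableSet G ∧
      ENNReal.ofReal (1 - δ) ≤ (Measure.pi fun _ : Fin n => Q) G ∧
      ∀ S ∈ G, ∀ θ, ∑ i, ((∫ z, h θ z ∂Q - ∫ z, h₀ z ∂Q) - (h θ (S i) - h₀ (S i))) ≤
        2 * R + B * √(2 * n * Real.log (1 / δ)) := by
  have hne (k : ℕ) : (Finset.range (k + 1)).Nonempty := Finset.nonempty_range_add_one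
  set X : ℕ → (Fin n → Z) → ℝ := fun θ S =>
    ∑ i, ((∫ z, h θ z ∂Q - ∫ z, h₀ z ∂Q) - (h θ (S i) - h₀ (S i))) with hX
  -- The bad events of the initial segments increase, so the measure of their union is a supremum of
  -- quantities at most `δ`, with no union-bound loss.
  set E : ℕ → Set (Fin n → Z) := fun k => {S | 2 * R + B * √(2 * n * Real.log (1 / δ)) ≤
    (Finset.range (k + 1)).sup' (hne k) fun θ => X θ S} with hE
  have hEm (k : ℕ) : MeasurableSet (E k) :=
    measurableSet_le measurable_const (measurable_sup' (hne k) fun θ => by fun_prop)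
  have hmono : Monotone E := fun k l hkl S hS => by
    simp only [hE, Set.mem_ofPred_eq] at hS ⊢
    exact hS.trans (Finset.sup'_mono _ (Finset.range_mono (Nat.succ_le_succ hkl)) (hne k))
  refine ⟨(⋃ k, E k)ᶜ, (MeasurableSet.iUnion hEm).compl, ?_, fun S hS θ => ?_⟩
  · rw [prob_compl_eq_one_sub (MeasurableSet.iUnion hEm), hmono.measure_iUnion,
      ENNReal.ofReal_sub _ hδ_pos.le, ENNReal.ofReal_one]
    refine tsub_le_tsub_left (iSup_le fun k => ?_) _
    exact measure_sup'_excess_ge_le (hne k) Q hn hm hB hm₀ hB₀ hB_pos (hR _ (hne k)) hδ_pos hδ_lt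
  · have : S ∉ E θ := fun hθ => hS (Set.mem_iUnion_of_mem θ hθ)
    simp only [hE, Set.mem_ofPred_eq] at this
    have h1 := not_le.1 this
    exact (Finset.le_sup' (fun θ => X θ S) (Finset.self_mem_range_succ θ)).trans h1.le

end DiverseNet

/-! ### Estimates for two-layer networks -/

namespace DiverseNet
open MeasureTheory

variable {D M : ℕ} {ρ : ℝ → ℝ}

/-- Exchanging sums reduces the network to its units, each bounded in absolute value because the `v
m` have either sign. The two signs of the centred activation `ρ - ρ 0` cost the factor 2 on `Lρ`;
the constant part `ρ 0` contributes a Rademacher sum of ones. -/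
theorem sum_sup'_network_le {n : ℕ} {Lρ : NNReal} (hρ_nonneg : ∀ t, 0 ≤ ρ t)
    (hρ_lip : LipschitzWith Lρ ρ) {C₁ C₃ C₄ : ℝ} (hC₁ : 0 ≤ C₁) (hC₃ : 0 ≤ C₃) (hC₄ : 0 ≤ C₄)
    {ι : Type*} {F : Finset ι} (hF : F.Nonempty) (W : ι → Fin M → EuclideanSpace ℝ (Fin D))
    (v : ι → Fin M → ℝ) (hW : ∀ θ m, ‖W θ m‖ ≤ C₃) (hv : ∀ θ, ‖v θ‖ ≤ C₄)
    (x : Fin n → EuclideanSpace ℝ (Fin D)) (hx : ∀ i, ‖x i‖ ≤ C₁) :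
    ∑ σ : Fin n → Bool, F.sup' hF
        (fun θ => ∑ i, boolSign (σ i) * network ρ (W θ) (v θ) (x i)) ≤
      2 ^ n * (C₄ * M * (2 * Lρ * C₁ * C₃ + ρ 0) * √n) := by
  classical
  -- The weight `0` is adjoined so that `P` and `P'` are nonnegative: the centred activation
  -- vanishes there. Hence `P + P'` dominates the absolute value.
  set U : Finset (EuclideanSpace ℝ (Fin D)) :=
    insert 0 (F.biUnion fun θ => Finset.univ.image (W θ)) with hU
  have hUne : U.Nonempty := Finset.insert_nonempty _ _
  have h0U : (0 : EuclideanSpace ℝ (Fin D)) ∈ U := Finset.mem_insert_self _ _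
  have hUC : ∀ w ∈ U, ‖w‖ ≤ C₃ := by
    intro w hw
    simp only [hU, Finset.mem_insert, Finset.mem_biUnion, Finset.mem_image, Finset.mem_univ,
      true_and] at hw
    obtain rfl | ⟨θ, -, m, rfl⟩ := hw
    · simpa using hC₃
    · exact hW θ m
  have hWU (θ : ι) (hθ : θ ∈ F) (m : Fin M) : W θ m ∈ U :=
    Finset.mem_insert_of_mem
      (Finset.mem_biUnion.2 ⟨θ, hθ, Finset.mem_image_of_mem _ (Finset.mem_univ m)⟩)
  have hψ : LipschitzWith Lρ fun t => ρ t - ρ 0 :=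
    LipschitzWith.of_dist_le_mul fun s t => by simpa using hρ_lip.dist_le_mul s t
  have hψ' : LipschitzWith Lρ fun t => -(ρ t - ρ 0) := hψ.neg
  have b1 := sum_sup'_linear_le hUne hC₃ hC₁ hUC x hx hψ
  have b2 := sum_sup'_linear_le hUne hC₃ hC₁ hUC x hx hψ'
  have b3 := sum_norm_rademacher_le (fun _ : Fin n => (1 : ℝ)) zero_le_one (by simp)
  simp only [smul_eq_mul, mul_one, Real.norm_eq_abs, one_mul] at b3
  set P : (Fin n → Bool) → ℝ := fun σ =>
    U.sup' hUne fun w => ∑ i, boolSign (σ i) * (ρ (inner ℝ w (x i)) - ρ 0) with hP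
  set P' : (Fin n → Bool) → ℝ := fun σ =>
    U.sup' hUne fun w => ∑ i, boolSign (σ i) * -(ρ (inner ℝ w (x i)) - ρ 0) with hP'
  have hP0 (σ) : 0 ≤ P σ := by
    simpa using Finset.le_sup'
      (fun w => ∑ i, boolSign (σ i) * (ρ (inner ℝ w (x i)) - ρ 0)) h0U
  have hP0' (σ) : 0 ≤ P' σ := by
    refine le_of_eq_of_le ?_ (Finset.le_sup'
      (fun w => ∑ i, boolSign (σ i) * -(ρ (inner ℝ w (x i)) - ρ 0)) h0U)
    simp
  have hunit (σ : Fin n → Bool) (w) (hw : w ∈ U) :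
      |∑ i, boolSign (σ i) * ρ (inner ℝ w (x i))| ≤
        P σ + P' σ + ρ 0 * |∑ i, boolSign (σ i)| := by
    have e : ∑ i, boolSign (σ i) * ρ (inner ℝ w (x i)) =
        ∑ i, boolSign (σ i) * (ρ (inner ℝ w (x i)) - ρ 0) + ρ 0 * ∑ i, boolSign (σ i) := by
      rw [Finset.mul_sum, ← Finset.sum_add_distrib]
      exact Finset.sum_congr rfl fun i _ => by ring
    rw [e]
    refine (abs_add_le _ _).trans (add_le_add ?_ ?_)
    · have u1 := Finset.le_sup'
        (fun w => ∑ i, boolSign (σ i) * (ρ (inner ℝ w (x i)) - ρ 0)) hw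
      have u2 := Finset.le_sup'
        (fun w => ∑ i, boolSign (σ i) * -(ρ (inner ℝ w (x i)) - ρ 0)) hw
      simp only [mul_neg, Finset.sum_neg_distrib] at u2
      simp only [hP, hP', mul_neg, Finset.sum_neg_distrib] at u1 hP0 hP0' ⊢
      refine abs_le.2 ⟨?_, ?_⟩ <;> linarith [hP0 σ, hP0' σ]
    · rw [abs_mul, abs_of_nonneg (hρ_nonneg 0)]
  calc _ ≤ ∑ σ : Fin n → Bool, M * (C₄ * (P σ + P' σ + ρ 0 * |∑ i, boolSign (σ i)|)) := by
        refine Finset.sum_le_sum fun σ _ => Finset.sup'_le hF _ fun θ hθ => ?_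
        have e : ∑ i, boolSign (σ i) * network ρ (W θ) (v θ) (x i) =
            ∑ m, v θ m * ∑ i, boolSign (σ i) * ρ (inner ℝ (W θ m) (x i)) := by
          simp only [network, feature, Finset.mul_sum]
          rw [Finset.sum_comm]
          exact Finset.sum_congr rfl fun m _ => Finset.sum_congr rfl fun i _ => by ring
        rw [e]
        calc _ ≤ ∑ _m : Fin M, C₄ * (P σ + P' σ + ρ 0 * |∑ i, boolSign (σ i)|) := by
              refine Finset.sum_le_sum fun m _ => (le_abs_self _).trans ?_
              rw [abs_mul]
              exact mul_le_mul ((norm_le_pi_norm (v θ) m).trans (hv θ))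
                (hunit σ _ (hWU θ hθ m)) (abs_nonneg _) hC₄
          _ = _ := by simp
    _ = M * (C₄ * (∑ σ, P σ + ∑ σ, P' σ +
          ρ 0 * ∑ σ : Fin n → Bool, |∑ i, boolSign (σ i)|)) := by
        simp only [Finset.mul_sum, ← Finset.sum_add_distrib]
    _ ≤ M * (C₄ * (2 ^ n * (Lρ * C₁ * C₃ * √n) + 2 ^ n * (Lρ * C₁ * C₃ * √n) +
          ρ 0 * (2 ^ n * √n))) := by
        gcongr
        exact hρ_nonneg 0
    _ = _ := by ring

/-- As `φ ≥ 0`, `|f| ≤ C₄ ∑ φ_m`. Expanding the pairwise squares, whose diagonal terms vanish, turns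
diversity into an upper bound on `(∑ φ_m)²`, with `φ_m ≤ C₅` bounding the rest. -/
theorem abs_network_le {Lρ : NNReal} (hM : 2 ≤ M) (hρ_nonneg : ∀ t, 0 ≤ ρ t)
    (hρ_lip : LipschitzWith Lρ ρ) {C₁ C₃ C₄ dmin : ℝ} (hC₃ : 0 ≤ C₃)
    {W : Fin M → EuclideanSpace ℝ (Fin D)} {v : Fin M → ℝ} (hW : ∀ m, ‖W m‖ ≤ C₃)
    (hv : ‖v‖ ≤ C₄) {x : EuclideanSpace ℝ (Fin D)} (hx : ‖x‖ ≤ C₁)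
    (hdiv : dmin ^ 2 ≤ diversity ρ W x) :
    |network ρ W v x| ≤ √(constJ M ρ Lρ C₁ C₃ C₄ dmin) := by
  set φ := feature ρ W x with hφ
  have hφ0 (m) : 0 ≤ φ m := hρ_nonneg _
  have hφC (m) : φ m ≤ constC₅ ρ Lρ C₁ C₃ := by
    have h1 := hρ_lip.dist_le_mul (inner ℝ (W m) x) 0
    rw [Real.dist_eq, Real.dist_eq, sub_zero] at h1
    have h2 : |inner ℝ (W m) x| ≤ C₃ * C₁ :=
      (abs_real_inner_le_norm _ _).trans (mul_le_mul (hW m) hx (norm_nonneg _) hC₃)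
    have h3 : Lρ * |inner ℝ (W m) x| ≤ Lρ * (C₃ * C₁) := by gcongr
    have h4 := (le_abs_self _).trans h1
    simp only [constC₅, hφ, feature]
    linarith
  have hM' : (2 : ℝ) ≤ M := by exact_mod_cast hM
  have hpairs : ∑ n : Fin M, ∑ m : Fin M with n ≠ m, (φ n - φ m) ^ 2 =
      2 * M * ∑ m, φ m ^ 2 - 2 * (∑ m, φ m) ^ 2 := by
    have e1 (n : Fin M) : ∑ m : Fin M with n ≠ m, (φ n - φ m) ^ 2 = ∑ m, (φ n - φ m) ^ 2 := by
      refine Finset.sum_subset (Finset.subset_univ _) fun m _ hm => ?_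
      have : n = m := by simpa using hm
      simp [this]
    rw [Finset.sum_congr rfl fun n _ => e1 n]
    simp only [sub_sq, Finset.sum_add_distrib, Finset.sum_sub_distrib, Finset.sum_const,
      Finset.card_univ, Fintype.card_fin, nsmul_eq_mul, ← Finset.mul_sum, ← Finset.sum_mul]
    ring
  have hsq : ∑ m, φ m ^ 2 ≤ M * constC₅ ρ Lρ C₁ C₃ ^ 2 := by
    calc _ ≤ ∑ _m : Fin M, constC₅ ρ Lρ C₁ C₃ ^ 2 :=
          Finset.sum_le_sum fun m _ => pow_le_pow_left₀ (hφ0 m) (hφC m) 2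
      _ = _ := by simp
  have hdiv' : dmin ^ 2 * (2 * M * (M - 1)) ≤ 2 * M * ∑ m, φ m ^ 2 - 2 * (∑ m, φ m) ^ 2 := by
    have hpos : (0 : ℝ) < 2 * M * (M - 1) := mul_pos (by linarith) (by linarith)
    rw [diversity, ← hφ, hpairs, one_div, inv_mul_eq_div, le_div_iff₀ hpos] at hdiv
    exact hdiv
  have hS : (∑ m, φ m) ^ 2 ≤ M * constC₅ ρ Lρ C₁ C₃ ^ 2
      + M * ((M : ℝ) - 1) * (constC₅ ρ Lρ C₁ C₃ ^ 2 - dmin ^ 2) := by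
    have := mul_le_mul_of_nonneg_left hsq (Nat.cast_nonneg (α := ℝ) M)
    nlinarith
  have habs : |network ρ W v x| ≤ C₄ * ∑ m, φ m := by
    rw [network, Finset.mul_sum]
    refine (Finset.abs_sum_le_sum_abs _ _).trans (Finset.sum_le_sum fun m _ => ?_)
    rw [abs_mul, ← hφ, abs_of_nonneg (hφ0 m)]
    exact mul_le_mul_of_nonneg_right ((norm_le_pi_norm v m).trans hv) (hφ0 m)
  refine Real.le_sqrt_of_sq_le ((pow_le_pow_left₀ (abs_nonneg _) habs 2).trans ?_)
  rw [mul_pow, constJ]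
  exact mul_le_mul_of_nonneg_left hS (sq_nonneg _)

theorem hingeLoss_nonneg (t y : ℝ) : 0 ≤ hingeLoss t y := le_max_left _ _

theorem hingeLoss_le {t y b : ℝ} (hy : y = -1 ∨ y = 1) (ht : |t| ≤ b) :
    hingeLoss t y ≤ 1 + b := by
  have := abs_le.1 ht
  refine max_le (by linarith) ?_
  rcases hy with rfl | rfl <;> linarith

theorem abs_hingeLoss_sub_le {y : ℝ} (hy : y = -1 ∨ y = 1) (s t : ℝ) :
    |hingeLoss s y - hingeLoss t y| ≤ |s - t| := by
  have h := abs_max_sub_max_le_abs (1 - y * s) (1 - y * t) 0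
  rw [max_comm, max_comm (1 - y * t)] at h
  refine h.trans_eq ?_
  have : |y| = 1 := by rcases hy with rfl | rfl <;> simp
  rw [show 1 - y * s - (1 - y * t) = y * (t - s) by ring, abs_mul, this, one_mul, abs_sub_comm]

theorem continuous_hingeLoss_network (hρ : Continuous ρ) :
    Continuous fun q : ((Fin M → EuclideanSpace ℝ (Fin D)) × (Fin M → ℝ)) ×
      (EuclideanSpace ℝ (Fin D) × ℝ) => hingeLoss (network ρ q.1.1 q.1.2 q.2.1) q.2.2 := by
  unfold hingeLoss network feature
  fun_prop

end DiverseNet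

/-! ### From countable families to the whole class -/

namespace DiverseNet
open MeasureTheory

/-- Uniform deviation bound for the excess risk over the class of diverse networks. -/
theorem exists_measurableSet_excessRisk_le {D M N : ℕ} (hM : 2 ≤ M) (hN : 1 ≤ N)
    {ρ : ℝ → ℝ} {Lρ : NNReal} (hρ_nonneg : ∀ t, 0 ≤ ρ t) (hρ_lip : LipschitzWith Lρ ρ)
    {C₁ C₃ C₄ dmin : ℝ} {X : Set (EuclideanSpace ℝ (Fin D))} (hX : ∀ x ∈ X, ‖x‖ ≤ C₁)
    (Q : Measure (EuclideanSpace ℝ (Fin D) × ℝ)) [IsProbabilityMeasure Q]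
    (hQ : ∀ᵐ z ∂Q, z.1 ∈ X ∧ (z.2 = -1 ∨ z.2 = 1)) {f₀ : EuclideanSpace ℝ (Fin D) → ℝ}
    (hf₀ : f₀ ∈ hypothesisClass M ρ X C₃ C₄ dmin) {δ : ℝ} (hδ_pos : 0 < δ) (hδ_lt : δ < 1) :
    ∃ G : Set (Fin N → EuclideanSpace ℝ (Fin D) × ℝ), MeasurableSet G ∧
      ENNReal.ofReal (1 - δ) ≤ Measure.pi (fun _ : Fin N => Q) G ∧
      ∀ S ∈ G, ∀ f ∈ hypothesisClass M ρ X C₃ C₄ dmin,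
        ∑ i, ((expectedRisk Q f - expectedRisk Q f₀) -
          (hingeLoss (f (S i).1) (S i).2 - hingeLoss (f₀ (S i).1) (S i).2)) ≤
        2 * (C₄ * M * (2 * Lρ * C₁ * C₃ + ρ 0) * √N) +
          (1 + √(constJ M ρ Lρ C₁ C₃ C₄ dmin)) * √(2 * N * Real.log (1 / δ)) := by
  set Θ : Set ((Fin M → EuclideanSpace ℝ (Fin D)) × (Fin M → ℝ)) :=
    {p | (∀ m, ‖p.1 m‖ ≤ C₃) ∧ ‖p.2‖ ≤ C₄ ∧ ∀ x ∈ X, dmin ^ 2 ≤ diversity ρ p.1 x}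
  obtain ⟨W₀, v₀, hW₀, hv₀, hd₀, rfl⟩ := hf₀
  have hne : Nonempty Θ := ⟨⟨(W₀, v₀), hW₀, hv₀, hd₀⟩⟩
  have hC₄ : 0 ≤ C₄ := (norm_nonneg _).trans hv₀
  have hC₃ : 0 ≤ C₃ := (norm_nonneg _).trans (hW₀ ⟨0, by omega⟩)
  obtain ⟨T, hTQ, hTm, hT⟩ := hQ.exists_measurable_mem
  obtain ⟨z₀, hz₀⟩ : T.Nonempty := (Filter.nonempty_of_mem hTQ)
  have hC₁ : 0 ≤ C₁ := (norm_nonneg _).trans (hX _ (hT z₀ hz₀).1)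
  classical
  -- `r` sends points outside the full-measure set `T` to `z₀ ∈ T`: the loss bounds then hold
  -- everywhere, while the risks are unchanged.
  set r : EuclideanSpace ℝ (Fin D) × ℝ → EuclideanSpace ℝ (Fin D) × ℝ :=
    T.piecewise id fun _ => z₀ with hr
  have hrm : Measurable r := measurable_id.piecewise hTm measurable_const
  have hr_eq {z} (hz : z ∈ T) : r z = z := Set.piecewise_eq_of_mem _ _ _ hz
  have hrT (z) : r z ∈ T := by
    by_cases hz : z ∈ T
    · rwa [hr_eq hz]
    · rw [hr, Set.piecewise_eq_of_notMem _ _ _ hz]; exact hz₀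
  set loss : (Fin M → EuclideanSpace ℝ (Fin D)) × (Fin M → ℝ) →
    EuclideanSpace ℝ (Fin D) × ℝ → ℝ := fun p z => hingeLoss (network ρ p.1 p.2 z.1) z.2 with hloss
  have hcont : Continuous (Function.uncurry loss) :=
    continuous_hingeLoss_network hρ_lip.continuous
  set B := 1 + √(constJ M ρ Lρ C₁ C₃ C₄ dmin)
  have hlossB (p) (hp : p ∈ Θ) (z) (hz : z ∈ T) : loss p z ∈ Set.Icc 0 B :=
    ⟨hingeLoss_nonneg _ _, hingeLoss_le (hT z hz).2
      (abs_network_le hM hρ_nonneg hρ_lip hC₃ hp.1 hp.2.1 (hX _ (hT z hz).1)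
        (hp.2.2 _ (hT z hz).1))⟩
  have hlossm (p) : Measurable (loss p) :=
    (hcont.comp (by fun_prop : Continuous fun z => (p, z))).measurable
  have hrisk (p) : ∫ z, loss p (r z) ∂Q = expectedRisk Q (network ρ p.1 p.2) := by
    refine integral_congr_ae ?_
    filter_upwards [hTQ] with z hz
    rw [hr_eq hz]
  -- Dominated convergence: on `T` the losses of all parameters in `Θ` share the bound `B`.
  have hriskc : Continuous fun p : Θ => ∫ z, loss p z ∂Q := by
    refine continuous_of_dominated (bound := fun _ => B)
      (fun p => (hlossm p).aestronglyMeasurable) (fun p => ?_) (integrable_const _)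
      (.of_forall fun z => hcont.comp (by fun_prop : Continuous fun p : Θ => (p.1, z)))
    filter_upwards [hTQ] with z hz
    have := hlossB p p.2 z hz
    rw [Real.norm_of_nonneg this.1]
    exact this.2
  set u : ℕ → Θ := TopologicalSpace.denseSeq Θ
  have hrad (F : Finset ℕ) (hF : F.Nonempty) (S : Fin N → EuclideanSpace ℝ (Fin D) × ℝ) :
      ∑ σ : Fin N → Bool, F.sup' hF (fun k => ∑ i, boolSign (σ i) * loss (u k) (r (S i))) ≤
        2 ^ N * (C₄ * M * (2 * Lρ * C₁ * C₃ + ρ 0) * √N) := by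
    have h1 := sum_sup'_contraction hF (fun i k => loss (u k) (r (S i)))
      (fun i k => network ρ (u k).1.1 (u k).1.2 (r (S i)).1)
      (fun i k k' => abs_hingeLoss_sub_le (hT _ (hrT (S i))).2 _ _) fun _ => 0
    simp only [zero_add] at h1
    exact h1.trans (sum_sup'_network_le hρ_nonneg hρ_lip hC₁ hC₃ hC₄ hF (fun k => (u k).1.1)
      (fun k => (u k).1.2) (fun k => (u k).2.1) (fun k => (u k).2.2.1) (fun i => (r (S i)).1)
      fun i => hX _ (hT _ (hrT (S i))).1)
  have hB_pos : 0 < B := by positivity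
  have hm (p) : Measurable fun z => loss p (r z) := (hlossm p).comp hrm
  have hIcc (p) (hp : p ∈ Θ) (z) : loss p (r z) ∈ Set.Icc 0 B := hlossB p hp _ (hrT z)
  obtain ⟨G, hGm, hGQ, hG⟩ := exists_measurableSet_excess_le Q hN
    (h := fun k z => loss (u k) (r z)) (h₀ := fun z => loss (W₀, v₀) (r z)) (B := B)
    (R := C₄ * M * (2 * Lρ * C₁ * C₃ + ρ 0) * √N)
    (fun k => hm (u k)) (fun k => hIcc (u k) (u k).2)
    (hm (W₀, v₀)) (hIcc (W₀, v₀) ⟨hW₀, hv₀, hd₀⟩) hB_pos hrad hδ_pos hδ_lt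
  have hT_ae : ∀ᵐ S ∂Measure.pi (fun _ : Fin N => Q), S ∈ ⋂ i, (fun S => S i) ⁻¹' T := by
    simp only [Set.mem_iInter, Set.mem_preimage]
    exact ae_all_iff.2 fun i =>
      (measurePreserving_eval (fun _ : Fin N => Q) i).quasiMeasurePreserving.ae hTQ
  refine ⟨(⋂ i, (fun S => S i) ⁻¹' T) ∩ G,
    (MeasurableSet.iInter fun i => measurable_pi_apply i hTm).inter hGm, ?_, ?_⟩
  · rwa [Measure.measure_inter_eq_of_ae hT_ae]
  rintro S ⟨hST, hSG⟩ f ⟨W, v, hW, hv, hd, rfl⟩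
  have hST' (i) : S i ∈ T := Set.mem_iInter.1 hST i
  have key (p : Θ) : ∑ i, ((∫ z, loss p z ∂Q - expectedRisk Q (network ρ W₀ v₀)) -
      (loss p (S i) - loss (W₀, v₀) (S i))) ≤
      2 * (C₄ * M * (2 * Lρ * C₁ * C₃ + ρ 0) * √N) + B * √(2 * N * Real.log (1 / δ)) := by
    -- For a fixed sample the inequality is a closed condition on the parameter, so it passes from
    -- the dense sequence to all of `Θ`.
    refine (TopologicalSpace.denseRange_denseSeq Θ).induction_on p ?_ fun k => ?_
    · refine isClosed_le (continuous_finsetSum _ fun i _ => ?_) continuous_const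
      have : Continuous fun p : Θ => loss p (S i) :=
        hcont.comp (by fun_prop : Continuous fun p : Θ => (p.1, S i))
      fun_prop
    · have := hG S hSG k
      simp only [hrisk, hr_eq (hST' _)] at this
      exact this
  exact key ⟨(W, v), hW, hv, hd⟩

end DiverseNet

theorem mainTheorem2 {D M N : ℕ} (hM : 2 ≤ M) (hN : 1 ≤ N)
    (ρ : ℝ → ℝ) (Lρ : NNReal) (hρ_nonneg : ∀ t, 0 ≤ ρ t) (hρ_lip : LipschitzWith Lρ ρ)
    (C₁ C₃ C₄ dmin : ℝ)
    (X : Set (EuclideanSpace ℝ (Fin D))) (hX : ∀ x ∈ X, ‖x‖ ≤ C₁)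
    (Q : MeasureTheory.Measure (EuclideanSpace ℝ (Fin D) × ℝ))
    [MeasureTheory.IsProbabilityMeasure Q]
    (hQ : ∀ᵐ z ∂Q, z.1 ∈ X ∧ (z.2 = -1 ∨ z.2 = 1))
    (fStar : EuclideanSpace ℝ (Fin D) → ℝ)
    (hfStar : DiverseNet.IsRiskMinimizer (DiverseNet.expectedRisk Q)
      (DiverseNet.hypothesisClass M ρ X C₃ C₄ dmin) fStar)
    (δ : ℝ) (hδ_pos : 0 < δ) (hδ_lt : δ < 1) :
    ∃ G : Set (Fin N → EuclideanSpace ℝ (Fin D) × ℝ),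
      MeasurableSet G ∧
      ENNReal.ofReal (1 - δ) ≤ MeasureTheory.Measure.pi (fun _ : Fin N => Q) G ∧
      ∀ S ∈ G, ∀ fHat : EuclideanSpace ℝ (Fin D) → ℝ,
        DiverseNet.IsRiskMinimizer (DiverseNet.empiricalRisk S)
          (DiverseNet.hypothesisClass M ρ X C₃ C₄ dmin) fHat →
        DiverseNet.expectedRisk Q fHat - DiverseNet.expectedRisk Q fStar ≤
          DiverseNet.constA M ρ Lρ C₁ C₃ C₄ / √(N : ℝ)
          + (1 + √(DiverseNet.constJ M ρ Lρ C₁ C₃ C₄ dmin))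
            * √(2 * Real.log (2 / δ) / (N : ℝ)) := by
  obtain ⟨G, hGm, hGQ, hG⟩ := DiverseNet.exists_measurableSet_excessRisk_le hM hN hρ_nonneg
    hρ_lip hX Q hQ hfStar.1 hδ_pos hδ_lt
  refine ⟨G, hGm, hGQ, fun S hS fHat hfHat => ?_⟩
  have hN' : (0 : ℝ) < N := by exact_mod_cast hN
  obtain ⟨z, hzX, -⟩ := hQ.exists
  have hC₁ : 0 ≤ C₁ := (norm_nonneg _).trans (hX _ hzX)
  obtain ⟨W₀, v₀, hW₀, hv₀, -, -⟩ := hfStar.1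
  have hC₄ : 0 ≤ C₄ := (norm_nonneg _).trans hv₀
  have hC₃ : 0 ≤ C₃ := (norm_nonneg _).trans (hW₀ ⟨0, by omega⟩)
  have h1 := hG S hS fHat hfHat.1
  -- Minimality makes the empirical excess nonpositive, so it can be dropped from `h1`.
  have h2 : DiverseNet.empiricalRisk S fHat ≤ DiverseNet.empiricalRisk S fStar :=
    hfHat.2 hfStar.1
  rw [DiverseNet.empiricalRisk, DiverseNet.empiricalRisk,
    mul_le_mul_iff_right₀ (by positivity)] at h2
  simp only [Finset.sum_sub_distrib, Finset.sum_const, Finset.card_univ, Fintype.card_fin,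
    nsmul_eq_mul] at h1
  have hsN : √(N : ℝ) * √N = N := Real.mul_self_sqrt hN'.le
  have hsN_pos : 0 < √(N : ℝ) := Real.sqrt_pos.2 hN'
  -- The one-sided tail yields `log (1 / δ)`; the stated `log (2 / δ)` is weaker.
  have hlog : Real.log (1 / δ) ≤ Real.log (2 / δ) :=
    Real.log_le_log (by positivity) (by gcongr; norm_num)
  have hroot : √(2 * N * Real.log (1 / δ)) ≤ N * √(2 * Real.log (2 / δ) / N) := by
    rw [← Real.sqrt_sq hN'.le, ← Real.sqrt_mul (sq_nonneg _), Real.sqrt_sq hN'.le]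
    refine Real.sqrt_le_sqrt ?_
    rw [show (N : ℝ) ^ 2 * (2 * Real.log (2 / δ) / N) = 2 * N * Real.log (2 / δ) by
      field_simp]
    gcongr
  -- The symmetrized mean accounts for only half of `constA`.
  have hA : 2 * (C₄ * M * (2 * Lρ * C₁ * C₃ + ρ 0) * √N) ≤
      N * (DiverseNet.constA M ρ Lρ C₁ C₃ C₄ / √(N : ℝ)) := by
    have hK : 0 ≤ C₄ * M * (2 * Lρ * C₁ * C₃ + ρ 0) * √N := by
      have := hρ_nonneg 0
      positivity
    have e : N * (DiverseNet.constA M ρ Lρ C₁ C₃ C₄ / √(N : ℝ)) =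
        4 * (C₄ * M * (2 * Lρ * C₁ * C₃ + ρ 0) * √N) := by
      rw [DiverseNet.constA, abs_of_nonneg (hρ_nonneg 0), mul_div_assoc', div_eq_iff hsN_pos.ne']
      linear_combination (-4 * C₄ * M * (2 * Lρ * C₁ * C₃ + ρ 0)) * hsN
    rw [e]
    linarith
  have hB := mul_le_mul_of_nonneg_left hroot
    (by positivity : 0 ≤ 1 + √(DiverseNet.constJ M ρ Lρ C₁ C₃ C₄ dmin))
  refine le_of_mul_le_mul_left ?_ hN'
  rw [mul_add]
  linarith
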